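/- Let $k\ge 2$ be an integer. There are constants $c_1,c_2>0$ depending only on $k$ such that the following holds for all integers $d,n\ge 1$, every tensor $A\in\mathbb{R}^{d\times\cdots\times d}$ of order $k$, every $\delta\in(0,1]$ and every $\beta>0$. Let $\omega_1,\dots,\omega_n$ be independent random variables, each uniformly distributed on $[d]^k$ (where $[d]=\{1,\dots,d\}$), and put $$X_i=d^k\,\mathcal{P}_{\omega_i}A,\qquad \bar X=\frac1n\sum_{i=1}^n X_i,$$ where $\mathcal{P}_\omega A$ is the tensor that agrees with $A$ at the entry $\omega$ and is zero at all other entries. Then, with probability at least $1-c_2d^{-\beta}$, $$\|\bar X-A\|_{\circ,\delta}\le c_1(1+\beta)\max\left\{\left(\frac{\log d}{n}\right)^{1/2}\delta^{k-2}d^{k-1/2},\ \left(\frac{\log d}{n}\right)\delta^{k-2}d^{k+1/2}\right\}\|A\|_{\max}.$$ Here $\|A\|_{\max}=\max_{\omega\in[d]^k}|A(\omega)|$, and for a tensor $X\in\mathbb{R}^{d\times\cdots\times d}$ of order $k$, $$\|X\|_{\circ,\delta}=\sup\langle u_1\otimes\cdots\otimes u_k,\,X\rangle,$$ where $\langle\cdot,\cdot\rangle$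 is the entrywise inner product and the supremum is over all pairs $1\le j_1<j_2\le k$ and all $u_1,\dots,u_k\in\mathbb{R}^d$ with $\|u_j\|_{\ell_2}\le 1$ for every $j$ and $\|u_j\|_{\ell_\infty}\le\delta$ for every $j\ne j_1,j_2$. -/

import Mathlib

open MeasureTheory ProbabilityTheory

noncomputable section

/-- Real `k`-th order hypercubic tensors of dimension `d × ⋯ × d`, as arrays indexed by `[d]^k`. -/
abbrev Tensor (k d : ℕ) : Type := (Fin k → Fin d) → ℝ

namespace Tensor

variable {k d : ℕ}

/-- The entrywise (vectorized) inner product of two tensors. -/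
def inner (X Y : Tensor k d) : ℝ := ∑ a, X a * Y a

/-- The max norm, i.e. the largest absolute value of an entry. -/
def maxNorm (A : Tensor k d) : ℝ := ⨆ a, |A a|

/-- The rank-one tensor `u₁ ⊗ ⋯ ⊗ u_k`. -/
def rankOne (u : Fin k → EuclideanSpace ℝ (Fin d)) : Tensor k d := fun a => ∏ j, u j (a j)

/-- Rank-one tensors with factors in the Euclidean unit ball, whose factors in all directions
other than `j₁` and `j₂` have sup norm at most `δ j`. -/
def incoherentPair (δ : Fin k → ℝ) (j₁ j₂ : Fin k) : Set (Tensor k d) :=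
  {Y | ∃ u : Fin k → EuclideanSpace ℝ (Fin d), Y = rankOne u ∧ (∀ j, ‖u j‖ ≤ 1) ∧
    ∀ j, j ≠ j₁ → j ≠ j₂ → ∀ i, |u j i| ≤ δ j}

/-- Rank-one tensors that are incoherent in all but two directions. -/
def incoherentSet (δ : Fin k → ℝ) : Set (Tensor k d) :=
  {Y | ∃ j₁ j₂ : Fin k, j₁ < j₂ ∧ Y ∈ incoherentPair δ j₁ j₂}

/-- The incoherent spectral norm `‖X‖_{∘,δ}`, the supremum of `⟨Y, X⟩` over `Y ∈ 𝒰(δ)`. -/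
def incoherentNorm (δ : Fin k → ℝ) (X : Tensor k d) : ℝ :=
  sSup ((fun Y => inner Y X) '' incoherentSet δ)

/-- The one-entry sample `d^k • P_ω A`, where `P_ω` keeps the entry at `ω` and sets all
other entries to zero. -/
def sample (A : Tensor k d) (ω : Fin k → Fin d) : Tensor k d :=
  ((d : ℝ) ^ k) • Set.indicator {ω} A

/-- The average of the samples at `n` positions. -/
def sampleMean {n : ℕ} (A : Tensor k d) (ω : Fin n → Fin k → Fin d) : Tensor k d :=
  ((n : ℝ)⁻¹) • ∑ i, sample A (ω i)

end Tensor

end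

/-!
The proof combines a net, a truncation and two Chernoff bounds. Write `lg = log d` and
`D = δ ^ (k - 2) d ^ k ‖A‖_max`, so that the claimed bound is `c₁ (1 + β) D τ` with
`τ = max (√(lg / n) d ^ (-1/2)) ((lg / n) d ^ (1/2))`.

Since the pairing with `u₁ ⊗ ⋯ ⊗ u_k` is multilinear, its supremum is controlled, up to a factor
`2 ^ k`, by finitely many tuples (`Tensor.incoherentNorm_le_of_testFactors`): in the two
unrestricted directions `u_j` runs through a `1 / 2`-net of the Euclidean ball, in the others it is
a vertex of the cube `[-δ, δ] ^ d`. A coordinate grid is fine enough for the net: there are only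
`exp (O(k d log d))` tuples, and the logarithms in the claim pay for the union bound over them.

A direct Bernstein bound fails for `u_{j₁}`, `u_{j₂}` concentrated on few coordinates. So the
rank-one tensor is cut at a threshold `θ` for the product `|u_{j₁}(a_{j₁}) u_{j₂}(a_{j₂})|`.
* Where the product is at most `θ`, the summands are bounded by `D θ` and have second moment at most
  `D ^ 2 / d ^ 2`. Bernstein's inequality with deviation level `O((1 + β) d lg)` applies
  (`Tensor.measureReal_flatPart_ge_le`).
* Where it exceeds `θ`, it is at most its square over `θ`. Since `u_{j₁}` and `u_{j₂}` are in the
  unit ball, this part has mean at most `D / (d ^ 2 θ)` and empirical average at most `D / (n θ)`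
  times the largest number of samples in a fibre over a pair of indices, which is at most `2 n / d ^ 2 + O((1 + β) lg)` with high probability
  (`Tensor.measureReal_count_ge_le`).

The choice `θ = n τ / (d lg)`, which satisfies `d θ ^ 2 ≥ 1` and `d ^ 3 lg θ ^ 2 ≥ n`, makes every
contribution `O((1 + β) D τ)`.
-/

/-! ### An exponential tail bound -/

theorem integral_comp_of_map_eq_uniformOn {α Ω : Type*} [Fintype α]
    [MeasurableSpace α] [DiscreteMeasurableSpace α] [MeasurableSpace Ω] {P : Measure Ω}
    [IsProbabilityMeasure P] {X : Ω → α} (hX : Measurable X)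
    (hunif : P.map X = uniformOn Set.univ) (g : α → ℝ) :
    ∫ x, g (X x) ∂P = (Fintype.card α : ℝ)⁻¹ * ∑ a, g a := by
  have hP : IsProbabilityMeasure (P.map X) := Measure.isProbabilityMeasure_map hX.aemeasurable
  have h := integral_map (μ := P) hX.aemeasurable (f := g)
    (Measurable.of_discrete).aestronglyMeasurable
  rw [← h, integral_fintype (.of_finite), Finset.mul_sum]
  refine Finset.sum_congr rfl fun a _ => ?_
  rw [hunif, Measure.real, uniformOn_univ]
  simp

/-- A one-sided Bernstein inequality for i.i.d. uniform samples, from `exp x ≤ 1 + x + x ^ 2` for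
`|x| ≤ 1`. The parameter `lam` is left free instead of being optimized. -/
theorem measureReal_sum_ge_le_exp {α Ω : Type*} [Fintype α] [Nonempty α]
    [MeasurableSpace α] [DiscreteMeasurableSpace α] [MeasurableSpace Ω] {P : Measure Ω}
    [IsProbabilityMeasure P] {n : ℕ} {ω : Fin n → Ω → α} (hω : ∀ i, Measurable (ω i))
    (hind : iIndepFun ω P) (hunif : ∀ i, P.map (ω i) = uniformOn Set.univ)
    (f : α → ℝ) {lam m s : ℝ} (t : ℝ) (hlam : 0 < lam) (hf : ∀ a, lam * |f a| ≤ 1)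
    (hm : ∑ a, f a ≤ Fintype.card α * m) (hs : ∑ a, f a ^ 2 ≤ Fintype.card α * s) :
    P.real {x | n * (m + lam * s) + t / lam ≤ ∑ i, f (ω i x)} ≤ Real.exp (-t) := by
  have hcard : (0 : ℝ) < Fintype.card α := by exact_mod_cast Fintype.card_pos
  have hmeas : ∀ i, Measurable (fun x => f (ω i x)) := fun i =>
    (Measurable.of_discrete (f := f)).comp (hω i)
  have hmgf : ∀ i, mgf (fun x => f (ω i x)) P lam ≤ Real.exp (lam * m + lam ^ 2 * s) := by
    intro i
    have h1 := integral_comp_of_map_eq_uniformOn (hω i) (hunif i)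
      (fun a => Real.exp (lam * f a))
    rw [mgf, h1]
    have h2 : ∑ a, Real.exp (lam * f a) ≤
        Fintype.card α * (1 + lam * m + lam ^ 2 * s) := by
      calc ∑ a, Real.exp (lam * f a)
          ≤ ∑ a, (1 + lam * f a + lam ^ 2 * f a ^ 2) := by
            refine Finset.sum_le_sum fun a _ => ?_
            have h3 : |lam * f a| ≤ 1 := by rw [abs_mul, abs_of_pos hlam]; exact hf a
            have h4 := (abs_le.1 (Real.abs_exp_sub_one_sub_id_le h3)).2
            nlinarith
        _ = Fintype.card α + lam * ∑ a, f a + lam ^ 2 * ∑ a, f a ^ 2 := by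
            simp [Finset.sum_add_distrib, Finset.mul_sum]
        _ ≤ Fintype.card α + lam * (Fintype.card α * m) + lam ^ 2 * (Fintype.card α * s) := by
            gcongr
        _ = _ := by ring
    rw [inv_mul_le_iff₀ hcard]
    refine h2.trans ?_
    gcongr
    have := Real.add_one_le_exp (lam * m + lam ^ 2 * s)
    linarith
  have hbdd : ∃ C, ∀ y, |∑ i, f (ω i y)| ≤ C := by
    refine ⟨∑ _i : Fin n, lam⁻¹, fun y => (Finset.abs_sum_le_sum_abs _ _).trans ?_⟩
    refine Finset.sum_le_sum fun i _ => ?_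
    rw [← one_div, le_div_iff₀' hlam]
    exact hf _
  obtain ⟨C, hC⟩ := hbdd
  have hint : Integrable (fun x => Real.exp (lam * ∑ i, f (ω i x))) P := by
    refine Integrable.of_bound (C := Real.exp (lam * C)) ?_ (.of_forall fun x => ?_)
    · exact (Real.measurable_exp.comp
        ((Finset.measurable_sum _ fun i _ => hmeas i).const_mul lam)).aestronglyMeasurable
    · rw [Real.norm_eq_abs, Real.abs_exp, Real.exp_le_exp]
      exact mul_le_mul_of_nonneg_left ((le_abs_self _).trans (hC x)) hlam.le
  have hsum : mgf (fun x => ∑ i, f (ω i x)) P lam ≤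
      Real.exp (n * (lam * m + lam ^ 2 * s)) := by
    have h1 : iIndepFun (fun i x => f (ω i x)) P :=
      hind.comp (fun _ => f) fun _ => Measurable.of_discrete
    have h2 := h1.mgf_sum (t := lam) hmeas Finset.univ
    have h3 : (∑ i, fun x => f (ω i x)) = fun x => ∑ i, f (ω i x) := by
      ext x; simp
    rw [h3] at h2
    rw [h2, Real.exp_nat_mul]
    calc _ ≤ ∏ _i : Fin n, Real.exp (lam * m + lam ^ 2 * s) :=
          Finset.prod_le_prod (fun i _ => mgf_nonneg) fun i _ => hmgf i
      _ = _ := by simp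
  refine (measure_ge_le_exp_mul_mgf _ hlam.le hint).trans ?_
  refine (mul_le_mul_of_nonneg_left hsum (Real.exp_pos _).le).trans ?_
  rw [← Real.exp_add, Real.exp_le_exp]
  have : lam * (t / lam) = t := by field_simp
  nlinarith

/-! ### Finite sets that norm a ball, a box and a product -/

/-- The Euclidean unit ball has a `1 / 2`-net inside it of cardinality `(4 d + 1) ^ d`: round each
coordinate towards zero to a multiple of `1 / (2 d)`. -/
theorem exists_half_net_unitBall (d : ℕ) (hd : 1 ≤ d) :
    ∃ G : Finset (EuclideanSpace ℝ (Fin d)), G.card ≤ (4 * d + 1) ^ d ∧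
      (∀ v ∈ G, ‖v‖ ≤ 1) ∧ ∀ u, ‖u‖ ≤ 1 → ∃ v ∈ G, ‖u - v‖ ≤ 1 / 2 := by
  classical
  have hN : (0 : ℝ) < 2 * d := by positivity
  let I : Finset (Fin d → ℤ) := Fintype.piFinset fun _ => Finset.Icc (-(2 * d : ℤ)) (2 * d)
  let φ : (Fin d → ℤ) → EuclideanSpace ℝ (Fin d) :=
    fun z => WithLp.toLp 2 fun i => (z i : ℝ) / (2 * d)
  have hI : I.card = (4 * d + 1) ^ d := by
    simp only [I, Fintype.card_piFinset, Int.card_Icc, Finset.prod_const, Finset.card_univ,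
      Fintype.card_fin]
    congr 1
    omega
  refine ⟨(I.image φ).filter (‖·‖ ≤ 1), ?_, fun v hv => (Finset.mem_filter.1 hv).2, ?_⟩
  · exact (Finset.card_filter_le _ _).trans (Finset.card_image_le.trans hI.le)
  intro u hu
  have hround : ∀ x : ℝ, |x| ≤ 1 → ∃ z : ℤ, -(2 * d : ℤ) ≤ z ∧ z ≤ 2 * d ∧
      |(z : ℝ) / (2 * d)| ≤ |x| ∧ |x - z / (2 * d)| ≤ 1 / (2 * d) := by
    -- nonnegative numbers are rounded down, and the rest follows by symmetry
    have key : ∀ x : ℝ, 0 ≤ x → x ≤ 1 → ∃ z : ℤ, 0 ≤ z ∧ z ≤ 2 * d ∧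
        (z : ℝ) / (2 * d) ≤ x ∧ x - z / (2 * d) ≤ 1 / (2 * d) := by
      intro x h0 h1
      have hfl := Int.floor_le (x * (2 * d))
      have hfl' := Int.lt_floor_add_one (x * (2 * d))
      refine ⟨⌊x * (2 * d)⌋, Int.floor_nonneg.2 (by positivity), ?_, ?_, ?_⟩
      · have : (⌊x * (2 * d)⌋ : ℝ) ≤ ((2 * d : ℤ) : ℝ) := by push_cast; nlinarith
        exact_mod_cast this
      · rwa [div_le_iff₀ hN]
      · rw [sub_le_iff_le_add, ← add_div, le_div_iff₀ hN]; linarith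
    intro x hx
    rcases le_total 0 x with h | h
    · obtain ⟨z, h1, h2, h3, h4⟩ := key x h (by rwa [abs_of_nonneg h] at hx)
      have hz : (0 : ℝ) ≤ z / (2 * d) := div_nonneg (by exact_mod_cast h1) hN.le
      exact ⟨z, by omega, h2, by rwa [abs_of_nonneg h, abs_of_nonneg hz],
        by rwa [abs_of_nonneg (by linarith)]⟩
    · obtain ⟨z, h1, h2, h3, h4⟩ := key (-x) (by linarith) (by rwa [abs_of_nonpos h] at hx)
      have hz : (0 : ℝ) ≤ z / (2 * d) := div_nonneg (by exact_mod_cast h1) hN.le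
      refine ⟨-z, by omega, by omega, ?_, ?_⟩
      · push_cast
        rwa [neg_div, abs_neg, abs_of_nonpos h, abs_of_nonneg hz]
      · push_cast
        rw [neg_div, abs_of_nonpos (by linarith)]; linarith
  have hcoord : ∀ i, |u i| ≤ 1 := fun i => (PiLp.norm_apply_le u i).trans hu
  choose z hz1 hz2 hz3 hz4 using fun i => hround (u i) (hcoord i)
  refine ⟨φ z, ?_, ?_⟩
  · refine Finset.mem_filter.2 ⟨Finset.mem_image_of_mem _ ?_, ?_⟩
    · simp only [I, Fintype.mem_piFinset, Finset.mem_Icc]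
      exact fun i => ⟨hz1 i, hz2 i⟩
    · refine le_trans ?_ hu
      rw [EuclideanSpace.norm_eq, EuclideanSpace.norm_eq]
      refine Real.sqrt_le_sqrt (Finset.sum_le_sum fun i _ => ?_)
      exact pow_le_pow_left₀ (norm_nonneg _) (hz3 i) 2
  · rw [EuclideanSpace.norm_eq, Real.sqrt_le_left (by norm_num)]
    calc ∑ i, ‖(u - φ z) i‖ ^ 2 ≤ ∑ _i : Fin d, (1 / (2 * d : ℝ)) ^ 2 :=
          Finset.sum_le_sum fun i _ => pow_le_pow_left₀ (norm_nonneg _) (hz4 i) 2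
      _ = 1 / (4 * d) := by
          have : (d : ℝ) ≠ 0 := by positivity
          simp; field_simp; norm_num
      _ ≤ (1 / 2) ^ 2 := by
          have : (1 : ℝ) ≤ d := by exact_mod_cast hd
          rw [div_le_iff₀ (by positivity)]; linarith

/-- `F` norms `K` up to a factor `2`: an upper bound for a linear functional on `F` is, after
doubling, an upper bound on `K`. -/
def TwoNorms {E : Type*} [AddCommGroup E] [Module ℝ E] (F K : Set E) : Prop :=
  ∀ (g : E →ₗ[ℝ] ℝ) (c : ℝ), 0 ≤ c → (∀ v ∈ F, g v ≤ c) → ∀ u ∈ K, g u ≤ 2 * c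

theorem twoNorms_of_half_net {d : ℕ} {G : Set (EuclideanSpace ℝ (Fin d))}
    (hG : ∀ u, ‖u‖ ≤ 1 → ∃ v ∈ G, ‖u - v‖ ≤ 1 / 2) : TwoNorms G {u | ‖u‖ ≤ 1} := by
  intro g c hc hgc u hu
  set w := (InnerProductSpace.toDual ℝ _).symm (LinearMap.toContinuousLinearMap g) with hw
  have hg : ∀ v, g v = inner ℝ w v := fun v => by
    rw [hw, InnerProductSpace.toDual_symm_apply]; rfl
  have hgu : g u ≤ ‖w‖ := by
    rw [hg]
    exact (real_inner_le_norm _ _).trans (mul_le_of_le_one_right (norm_nonneg _) hu)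
  refine hgu.trans ?_
  rcases eq_or_ne w 0 with h0 | h0
  · rw [h0, norm_zero]; linarith
  have hpos : 0 < ‖w‖ := norm_pos_iff.2 h0
  -- compare the maximizer of `g` on the ball with a nearby point of the net
  obtain ⟨v, hv, hdist⟩ := hG (‖w‖⁻¹ • w) (by rw [norm_smul]; simp [hpos.ne'])
  have h1 := hgc v hv
  have h2 : inner ℝ w (‖w‖⁻¹ • w - v) ≤ ‖w‖ * (1 / 2) :=
    (real_inner_le_norm _ _).trans (by gcongr)
  rw [inner_sub_right, inner_smul_right, real_inner_self_eq_norm_sq, ← hg] at h2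
  have h3 : ‖w‖⁻¹ * ‖w‖ ^ 2 = ‖w‖ := by field_simp
  linarith

/-- The vertices of the cube `[-δ, δ] ^ d`. -/
noncomputable def cubeVertices (d : ℕ) (δ : ℝ) : Finset (EuclideanSpace ℝ (Fin d)) := by
  classical
  exact Finset.univ.image fun s : Fin d → Bool => WithLp.toLp 2 fun i => if s i then δ else -δ

theorem card_cubeVertices_le (d : ℕ) (δ : ℝ) : (cubeVertices d δ).card ≤ 2 ^ d := by
  classical
  refine Finset.card_image_le.trans ?_
  simp

theorem abs_le_of_mem_cubeVertices {d : ℕ} {δ : ℝ} (hδ : 0 ≤ δ) {v : EuclideanSpace ℝ (Fin d)}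
    (hv : v ∈ cubeVertices d δ) (i : Fin d) : |v i| ≤ δ := by
  classical
  obtain ⟨s, -, rfl⟩ := Finset.mem_image.1 hv
  cases h : s i <;> simp [h, abs_of_nonneg hδ]

theorem twoNorms_cubeVertices (d : ℕ) (δ : ℝ) :
    TwoNorms (cubeVertices d δ : Set (EuclideanSpace ℝ (Fin d))) {u | ∀ i, |u i| ≤ δ} := by
  classical
  intro g c hc hgc u hu
  have hg : ∀ v, g v = ∑ i, v i * g (EuclideanSpace.basisFun (Fin d) ℝ i) := fun v => by
    conv_lhs => rw [← (EuclideanSpace.basisFun (Fin d) ℝ).sum_repr v]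
    simp
  let s : Fin d → Bool := fun i => 0 ≤ g (EuclideanSpace.basisFun (Fin d) ℝ i)
  have hv := hgc (WithLp.toLp 2 fun i => if s i then δ else -δ)
    (Finset.mem_coe.2 (Finset.mem_image_of_mem _ (Finset.mem_univ s)))
  refine le_trans ?_ (hv.trans (by linarith))
  rw [hg u, hg]
  refine Finset.sum_le_sum fun i _ => ?_
  have h1 := abs_le.1 (hu i)
  by_cases h : 0 ≤ g (EuclideanSpace.basisFun (Fin d) ℝ i)
  · simp only [s, h, decide_true, if_true]
    exact mul_le_mul_of_nonneg_right h1.2 h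
  · simp only [s, h, decide_false, Bool.false_eq_true, if_false]
    exact mul_le_mul_of_nonpos_right h1.1 (not_le.1 h).le

/-- Sets that norm each factor norm the product for multilinear forms, with constant `2 ^ k`. -/
theorem MultilinearMap.le_two_pow_mul_of_twoNorms {k : ℕ} {E : Type*} [AddCommGroup E]
    [Module ℝ E] (T : MultilinearMap ℝ (fun _ : Fin k => E) ℝ) {F K : Fin k → Set E}
    (hFK : ∀ j, TwoNorms (F j) (K j)) {c : ℝ} (hc : 0 ≤ c)
    (hT : ∀ u, (∀ j, u j ∈ F j) → T u ≤ c) {u : Fin k → E} (hu : ∀ j, u j ∈ K j) :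
    T u ≤ 2 ^ k * c := by
  classical
  have key : ∀ s : Finset (Fin k), ∀ u : Fin k → E, (∀ j ∈ s, u j ∈ K j) →
      (∀ j ∉ s, u j ∈ F j) → T u ≤ 2 ^ s.card * c := by
    intro s
    induction s using Finset.induction_on with
    | empty => intro u _ h; simpa using hT u (by simpa using h)
    | insert i s hi ih =>
      intro u hK hF
      have h := hFK i (T.toLinearMap u i) (2 ^ s.card * c) (by positivity) ?_ (u i)
        (hK i (Finset.mem_insert_self _ _))
      · rw [Finset.card_insert_of_notMem hi, pow_succ]
        simp only [MultilinearMap.toLinearMap_apply, Function.update_eq_self] at h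
        linarith
      · intro v hv
        refine ih _ (fun j hj => ?_) fun j hj => ?_
        · have hne : j ≠ i := fun h => hi (h ▸ hj)
          rw [Function.update_of_ne hne]
          exact hK j (Finset.mem_insert_of_mem hj)
        · by_cases hji : j = i
          · subst hji; simpa using hv
          · rw [Function.update_of_ne hji]
            exact hF j (by simp [hji, hj])
  simpa using key Finset.univ u (fun j _ => hu j) (by simp)

namespace Tensor

/-! ### Reduction to finitely many rank-one tensors -/

/-- The pairing `u ↦ ⟨u₁ ⊗ ⋯ ⊗ u_k, X⟩` as a multilinear form. -/
noncomputable def rankOnePairing {k d : ℕ} (X : Tensor k d) :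
    MultilinearMap ℝ (fun _ : Fin k => EuclideanSpace ℝ (Fin d)) ℝ :=
  ∑ a, X a • (MultilinearMap.mkPiAlgebra ℝ (Fin k) ℝ).compLinearMap
    fun j => PiLp.projₗ 2 (fun _ : Fin d => ℝ) (a j)

theorem rankOnePairing_apply {k d : ℕ} (X : Tensor k d)
    (u : Fin k → EuclideanSpace ℝ (Fin d)) :
    rankOnePairing X u = inner (rankOne u) X := by
  simp [rankOnePairing, inner, rankOne, mul_comm]

/-- Tuples of test vectors: net points of the ball in the directions `j₁` and `j₂`, and vertices
of the cube in all other directions. -/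
noncomputable def testFactors {d : ℕ} (k : ℕ) (G : Finset (EuclideanSpace ℝ (Fin d))) (δ : ℝ)
    (j₁ j₂ : Fin k) : Finset (Fin k → EuclideanSpace ℝ (Fin d)) :=
  Fintype.piFinset fun j => if j = j₁ ∨ j = j₂ then G else cubeVertices d δ

theorem card_testFactors_le {k d m : ℕ} {G : Finset (EuclideanSpace ℝ (Fin d))}
    (hG : G.card ≤ m) (hm : 2 ^ d ≤ m) (δ : ℝ) (j₁ j₂ : Fin k) :
    (testFactors k G δ j₁ j₂).card ≤ m ^ k := by
  rw [testFactors, Fintype.card_piFinset]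
  calc _ ≤ ∏ _j : Fin k, m := Finset.prod_le_prod' fun j _ => by
        split_ifs
        exacts [hG, (card_cubeVertices_le d δ).trans hm]
    _ = m ^ k := by simp

theorem incoherentNorm_le_of_testFactors {k d : ℕ} {G : Finset (EuclideanSpace ℝ (Fin d))}
    (hG : ∀ u, ‖u‖ ≤ 1 → ∃ v ∈ G, ‖u - v‖ ≤ 1 / 2) {δ c : ℝ} (hc : 0 ≤ c) {X : Tensor k d}
    (h : ∀ j₁ j₂ : Fin k, j₁ < j₂ → ∀ u ∈ testFactors k G δ j₁ j₂, inner (rankOne u) X ≤ c) :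
    incoherentNorm (fun _ => δ) X ≤ 2 ^ k * c := by
  refine Real.sSup_le ?_ (by positivity)
  rintro _ ⟨_, ⟨j₁, j₂, hlt, u, rfl, hball, hcube⟩, rfl⟩
  change inner (rankOne u) X ≤ _
  rw [← rankOnePairing_apply]
  refine (rankOnePairing X).le_two_pow_mul_of_twoNorms
    (F := fun j => if j = j₁ ∨ j = j₂ then (G : Set _) else cubeVertices d δ)
    (K := fun j => if j = j₁ ∨ j = j₂ then {v | ‖v‖ ≤ 1} else {v | ∀ i, |v i| ≤ δ})
    (fun j => ?_) hc (fun v hv => ?_) (fun j => ?_)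
  · dsimp only
    split_ifs
    exacts [twoNorms_of_half_net hG, twoNorms_cubeVertices d δ]
  · rw [rankOnePairing_apply]
    refine h j₁ j₂ hlt v (Fintype.mem_piFinset.2 fun j => ?_)
    have := hv j
    split_ifs at this ⊢
    exacts [this, this]
  · dsimp only
    split_ifs with hj
    · exact hball j
    · rw [not_or] at hj
      exact hcube j hj.1 hj.2

/-! ### Products with two distinguished directions -/

theorem prod_le_mul_mul_pow {k : ℕ} {j₁ j₂ : Fin k} (hne : j₁ ≠ j₂) {x : Fin k → ℝ} {q : ℝ}
    (hx : ∀ j, 0 ≤ x j) (hq : ∀ j, j ≠ j₁ → j ≠ j₂ → x j ≤ q) :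
    ∏ j, x j ≤ x j₁ * x j₂ * q ^ (k - 2) := by
  have h2 : j₂ ∈ Finset.univ.erase j₁ := by simp [hne.symm]
  rw [← Finset.mul_prod_erase _ _ (Finset.mem_univ j₁), ← Finset.mul_prod_erase _ _ h2,
    ← mul_assoc]
  refine mul_le_mul_of_nonneg_left ?_ (mul_nonneg (hx _) (hx _))
  have hcard : ((Finset.univ.erase j₁).erase j₂).card = k - 2 := by
    rw [Finset.card_erase_of_mem h2, Finset.card_erase_of_mem (Finset.mem_univ _)]
    simp; omega
  calc _ ≤ ∏ _j ∈ (Finset.univ.erase j₁).erase j₂, q :=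
        Finset.prod_le_prod (fun j _ => hx j) fun j hj => by
          simp only [Finset.mem_erase] at hj
          exact hq j hj.2.1 hj.1
    _ = q ^ (k - 2) := by rw [Finset.prod_const, hcard]

theorem sum_prod_le_pow {k d : ℕ} {j₁ j₂ : Fin k} (hne : j₁ ≠ j₂) {g : Fin k → Fin d → ℝ}
    {q : ℝ} (hg : ∀ j i, 0 ≤ g j i) (h₁ : ∑ i, g j₁ i ≤ 1) (h₂ : ∑ i, g j₂ i ≤ 1) (hq0 : 0 ≤ q)
    (hq : ∀ j, j ≠ j₁ → j ≠ j₂ → ∑ i, g j i ≤ q) :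
    ∑ a : Fin k → Fin d, ∏ j, g j (a j) ≤ q ^ (k - 2) := by
  have hs : ∀ j, 0 ≤ ∑ i, g j i := fun j => Finset.sum_nonneg fun i _ => hg j i
  have h := Finset.prod_univ_sum (fun _ : Fin k => (Finset.univ : Finset (Fin d))) g
  rw [Fintype.piFinset_univ] at h
  rw [← h]
  refine (prod_le_mul_mul_pow hne hs hq).trans ?_
  exact mul_le_of_le_one_left (by positivity) (mul_le_one₀ h₁ (hs _) h₂)

/-- Summing a product of functions of the coordinates `j₁` and `j₂` over `[d]^k`. -/
theorem sum_mul_le_pow {k d : ℕ} {j₁ j₂ : Fin k} (hne : j₁ ≠ j₂) {g₁ g₂ : Fin d → ℝ}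
    (hg₁ : ∀ i, 0 ≤ g₁ i) (hg₂ : ∀ i, 0 ≤ g₂ i) (h₁ : ∑ i, g₁ i ≤ 1) (h₂ : ∑ i, g₂ i ≤ 1) :
    ∑ a : Fin k → Fin d, g₁ (a j₁) * g₂ (a j₂) ≤ (d : ℝ) ^ (k - 2) := by
  classical
  let g : Fin k → Fin d → ℝ := fun j => if j = j₁ then g₁ else if j = j₂ then g₂ else 1
  have e₁ : g j₁ = g₁ := by simp [g]
  have e₂ : g j₂ = g₂ := by simp [g, hne.symm]
  have e : ∀ j, j ≠ j₁ → j ≠ j₂ → g j = 1 := fun j h h' => by simp [g, h, h']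
  have h := sum_prod_le_pow (g := g) (q := d) hne (fun j i => ?_) (by rwa [e₁]) (by rwa [e₂])
    (by positivity) (fun j h h' => by simp [e j h h'])
  · refine (Finset.sum_congr rfl fun a _ => ?_).trans_le h
    rw [Fintype.prod_eq_mul j₁ j₂ hne fun j hj => by rw [e j hj.1 hj.2]; rfl, e₁, e₂]
  · dsimp only [g]
    split_ifs
    exacts [hg₁ i, hg₂ i, zero_le_one]

/-! ### Flat and spiky parts of a rank-one tensor -/

/-- A tuple of test vectors: two unit-ball factors in the directions `j₁` and `j₂`, all others
with entries bounded by `δ`. -/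
structure IsTest {k d : ℕ} (δ : ℝ) (j₁ j₂ : Fin k) (u : Fin k → EuclideanSpace ℝ (Fin d)) :
    Prop where
  norm_left : ‖u j₁‖ ≤ 1
  norm_right : ‖u j₂‖ ≤ 1
  abs_le : ∀ j, j ≠ j₁ → j ≠ j₂ → ∀ i, |u j i| ≤ δ

theorem isTest_of_mem_testFactors {k d : ℕ} {G : Finset (EuclideanSpace ℝ (Fin d))}
    (hG : ∀ v ∈ G, ‖v‖ ≤ 1) {δ : ℝ} (hδ : 0 ≤ δ) {j₁ j₂ : Fin k}
    {u : Fin k → EuclideanSpace ℝ (Fin d)} (hu : u ∈ testFactors k G δ j₁ j₂) :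
    IsTest δ j₁ j₂ u := by
  have h := Fintype.mem_piFinset.1 hu
  refine ⟨hG _ ?_, hG _ ?_, fun j h₁ h₂ => abs_le_of_mem_cubeVertices hδ ?_⟩
  · simpa using h j₁
  · simpa using h j₂
  · simpa [h₁, h₂] using h j

/-- The part of `rankOne u` where the factors `j₁` and `j₂` have product at most `θ`. -/
noncomputable def flatPart {k d : ℕ} (θ : ℝ) (j₁ j₂ : Fin k)
    (u : Fin k → EuclideanSpace ℝ (Fin d)) : Tensor k d :=
  fun a => if |u j₁ (a j₁)| * |u j₂ (a j₂)| ≤ θ then rankOne u a else 0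

section Parts

variable {k d : ℕ} {δ θ : ℝ} {j₁ j₂ : Fin k} {u : Fin k → EuclideanSpace ℝ (Fin d)}

theorem sum_sq_le_one {v : EuclideanSpace ℝ (Fin d)} (hv : ‖v‖ ≤ 1) : ∑ i, v i ^ 2 ≤ 1 := by
  rw [← EuclideanSpace.real_norm_sq_eq]
  exact pow_le_one₀ (norm_nonneg _) hv

theorem IsTest.abs_rankOne_le (hu : IsTest δ j₁ j₂ u) (hne : j₁ ≠ j₂) (a : Fin k → Fin d) :
    |rankOne u a| ≤ |u j₁ (a j₁)| * |u j₂ (a j₂)| * δ ^ (k - 2) := by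
  rw [rankOne, Finset.abs_prod]
  exact prod_le_mul_mul_pow (x := fun j => |u j (a j)|) hne (fun _ => abs_nonneg _)
    fun j h h' => hu.abs_le j h h' _

theorem IsTest.abs_flatPart_le (hu : IsTest δ j₁ j₂ u) (hne : j₁ ≠ j₂) (hδ : 0 ≤ δ) (hθ : 0 ≤ θ)
    (a : Fin k → Fin d) : |flatPart θ j₁ j₂ u a| ≤ θ * δ ^ (k - 2) := by
  rw [flatPart]
  split_ifs with h
  · exact (hu.abs_rankOne_le hne a).trans (by gcongr)
  · rw [abs_zero]; positivity

theorem IsTest.sum_flatPart_sq_le (hu : IsTest δ j₁ j₂ u) (hne : j₁ ≠ j₂) :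
    ∑ a, flatPart θ j₁ j₂ u a ^ 2 ≤ (d * δ ^ 2) ^ (k - 2) := by
  calc ∑ a, flatPart θ j₁ j₂ u a ^ 2 ≤ ∑ a : Fin k → Fin d, ∏ j, u j (a j) ^ 2 := by
        refine Finset.sum_le_sum fun a _ => ?_
        rw [Finset.prod_pow, flatPart]
        split_ifs
        · rfl
        · rw [zero_pow two_ne_zero]; positivity
    _ ≤ _ := by
        refine sum_prod_le_pow (g := fun j i => u j i ^ 2) hne (fun _ _ => sq_nonneg _)
          (sum_sq_le_one hu.norm_left) (sum_sq_le_one hu.norm_right) (by positivity) fun j h h' => ?_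
        calc ∑ i, u j i ^ 2 ≤ ∑ _i : Fin d, δ ^ 2 :=
              Finset.sum_le_sum fun i _ => sq_le_sq.2 ((hu.abs_le j h h' i).trans (le_abs_self _))
          _ = d * δ ^ 2 := by simp

/-- On the spiky part the product `x` of the two unrestricted factors exceeds `θ`, so
`x ≤ x ^ 2 / θ`. -/
theorem IsTest.abs_sub_flatPart_le (hu : IsTest δ j₁ j₂ u) (hne : j₁ ≠ j₂) (hδ : 0 ≤ δ)
    (hθ : 0 < θ) (a : Fin k → Fin d) :
    |rankOne u a - flatPart θ j₁ j₂ u a| ≤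
      δ ^ (k - 2) / θ * (u j₁ (a j₁) ^ 2 * u j₂ (a j₂) ^ 2) := by
  rw [flatPart]
  split_ifs with h
  · rw [sub_self, abs_zero]; positivity
  · rw [sub_zero]
    refine (hu.abs_rankOne_le hne a).trans ?_
    rw [div_mul_eq_mul_div, le_div_iff₀ hθ, ← sq_abs (u j₁ _), ← sq_abs (u j₂ _), ← mul_pow]
    have hx : 0 ≤ |u j₁ (a j₁)| * |u j₂ (a j₂)| := by positivity
    have hδ' : 0 ≤ δ ^ (k - 2) := by positivity
    nlinarith [mul_le_mul_of_nonneg_left (not_le.1 h).le (mul_nonneg hx hδ')]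

/-- If every pair of indices occurs at most `N` times in the directions `j₁`, `j₂` of a sample,
then unit vectors see at most `N` of it. -/
theorem sum_sq_mul_sq_le_of_count {n : ℕ} {N : ℝ} {v w : EuclideanSpace ℝ (Fin d)} (hv : ‖v‖ ≤ 1)
    (hw : ‖w‖ ≤ 1) (hN : 0 ≤ N) (ω : Fin n → Fin k → Fin d)
    (hω : ∀ p q, ∑ i, (if ω i j₁ = p then 1 else 0) * (if ω i j₂ = q then (1 : ℝ) else 0) ≤ N) :
    ∑ i, v (ω i j₁) ^ 2 * w (ω i j₂) ^ 2 ≤ N := by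
  calc ∑ i, v (ω i j₁) ^ 2 * w (ω i j₂) ^ 2
      = ∑ i, ∑ p, ∑ q, v p ^ 2 * w q ^ 2 *
          ((if ω i j₁ = p then 1 else 0) * (if ω i j₂ = q then (1 : ℝ) else 0)) := by simp
    _ = ∑ p, ∑ q, v p ^ 2 * w q ^ 2 *
          ∑ i, (if ω i j₁ = p then 1 else 0) * (if ω i j₂ = q then (1 : ℝ) else 0) := by
        rw [Finset.sum_comm]
        refine Finset.sum_congr rfl fun p _ => ?_
        rw [Finset.sum_comm]
        simp_rw [Finset.mul_sum]
    _ ≤ ∑ p, ∑ q, v p ^ 2 * w q ^ 2 * N := by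
        gcongr with p _ q _
        exact hω p q
    _ = (∑ p, v p ^ 2) * (∑ q, w q ^ 2) * N := by
        simp_rw [← Finset.sum_mul, ← Finset.mul_sum, ← Finset.sum_mul]
    _ ≤ N := mul_le_of_le_one_left hN (mul_le_one₀ (sum_sq_le_one hv)
        (Finset.sum_nonneg fun _ _ => sq_nonneg _) (sum_sq_le_one hw))

end Parts

theorem abs_le_maxNorm {k d : ℕ} (A : Tensor k d) (a : Fin k → Fin d) : |A a| ≤ maxNorm A :=
  le_ciSup (f := fun a => |A a|) (Set.finite_range _).bddAbove a

theorem inner_sampleMean_sub {k d n : ℕ} (W A : Tensor k d) (ω : Fin n → Fin k → Fin d) :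
    inner W (sampleMean A ω - A) =
      (n : ℝ)⁻¹ * ∑ i, (d : ℝ) ^ k * (A (ω i) * W (ω i)) - ∑ a, A a * W a := by
  have h : ∀ o : Fin k → Fin d, ∑ a, W a * sample A o a = (d : ℝ) ^ k * (A o * W o) := by
    intro o
    rw [Finset.sum_eq_single o]
    · simp [sample]; ring
    · intro b _ hb; simp [sample, hb]
    · simp
  simp only [inner, Pi.sub_apply, mul_sub, Finset.sum_sub_distrib, sampleMean, Pi.smul_apply,
    Finset.sum_apply, smul_eq_mul]
  congr 1
  · simp_rw [← h, Finset.mul_sum]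
    rw [Finset.sum_comm]
    refine Finset.sum_congr rfl fun i _ => Finset.sum_congr rfl fun a _ => ?_
    ring
  · exact Finset.sum_congr rfl fun a _ => mul_comm _ _

/-- Deterministic bound for one test tensor: `hflat` controls the fluctuation of the flat part and
`hcount` the number of samples in each fibre over a pair of indices, hence the spiky part. -/
theorem inner_rankOne_sampleMean_sub_le {k d n : ℕ} (hn : 1 ≤ n) {A : Tensor k d} {δ θ N B : ℝ}
    {j₁ j₂ : Fin k} (hne : j₁ ≠ j₂) {u : Fin k → EuclideanSpace ℝ (Fin d)} (hδ : 0 ≤ δ)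
    (hθ : 0 < θ) (hN : 0 ≤ N) (hu : IsTest δ j₁ j₂ u) (ω : Fin n → Fin k → Fin d)
    (hflat : ∑ i, (d : ℝ) ^ k * (A (ω i) * flatPart θ j₁ j₂ u (ω i)) ≤
      n * (∑ a, A a * flatPart θ j₁ j₂ u a) + B)
    (hcount : ∀ p q,
      ∑ i, (if ω i j₁ = p then 1 else 0) * (if ω i j₂ = q then (1 : ℝ) else 0) ≤ N) :
    inner (rankOne u) (sampleMean A ω - A) ≤
      (n : ℝ)⁻¹ * (B + d ^ k * maxNorm A * (δ ^ (k - 2) / θ) * N) +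
        maxNorm A * (δ ^ (k - 2) / θ) * d ^ (k - 2) := by
  have hn' : (0 : ℝ) < n := by exact_mod_cast hn
  have hA : ∀ a, |A a| ≤ maxNorm A := abs_le_maxNorm A
  have hpt : ∀ a, |A a * (rankOne u a - flatPart θ j₁ j₂ u a)| ≤
      maxNorm A * (δ ^ (k - 2) / θ) * (u j₁ (a j₁) ^ 2 * u j₂ (a j₂) ^ 2) := fun a => by
    rw [abs_mul, mul_assoc]
    exact mul_le_mul (hA a) (hu.abs_sub_flatPart_le hne hδ hθ a) (abs_nonneg _)
      ((abs_nonneg _).trans (hA a))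
  have hM : 0 ≤ maxNorm A := Real.iSup_nonneg fun _ => abs_nonneg _
  have hspiky : ∑ i, (d : ℝ) ^ k * (A (ω i) * (rankOne u (ω i) - flatPart θ j₁ j₂ u (ω i))) ≤
      d ^ k * maxNorm A * (δ ^ (k - 2) / θ) * N := by
    calc _ ≤ ∑ i, (d : ℝ) ^ k * (maxNorm A * (δ ^ (k - 2) / θ) *
          (u j₁ (ω i j₁) ^ 2 * u j₂ (ω i j₂) ^ 2)) := by
          exact Finset.sum_le_sum fun i _ => mul_le_mul_of_nonneg_left
            ((le_abs_self _).trans (hpt _)) (by positivity)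
      _ = d ^ k * maxNorm A * (δ ^ (k - 2) / θ) *
          ∑ i, u j₁ (ω i j₁) ^ 2 * u j₂ (ω i j₂) ^ 2 := by
          simp_rw [Finset.mul_sum, mul_assoc]
      _ ≤ _ := by
          gcongr
          exact sum_sq_mul_sq_le_of_count hu.norm_left hu.norm_right hN ω hcount
  have hmean : -∑ a, A a * (rankOne u a - flatPart θ j₁ j₂ u a) ≤
      maxNorm A * (δ ^ (k - 2) / θ) * d ^ (k - 2) := by
    rw [← Finset.sum_neg_distrib]
    calc _ ≤ ∑ a : Fin k → Fin d, maxNorm A * (δ ^ (k - 2) / θ) *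
          (u j₁ (a j₁) ^ 2 * u j₂ (a j₂) ^ 2) :=
          Finset.sum_le_sum fun a _ => (neg_le_abs _).trans (hpt a)
      _ ≤ _ := by
          rw [← Finset.mul_sum]
          gcongr
          exact sum_mul_le_pow (g₁ := fun i => u j₁ i ^ 2) (g₂ := fun i => u j₂ i ^ 2) hne
            (fun _ => sq_nonneg _) (fun _ => sq_nonneg _) (sum_sq_le_one hu.norm_left)
            (sum_sq_le_one hu.norm_right)
  rw [inner_sampleMean_sub]
  simp only [mul_sub, Finset.sum_sub_distrib] at hspiky hmean
  have h1 : ∑ i, (d : ℝ) ^ k * (A (ω i) * rankOne u (ω i)) ≤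
      n * (∑ a, A a * flatPart θ j₁ j₂ u a) + (B + d ^ k * maxNorm A * (δ ^ (k - 2) / θ) * N) := by
    linarith
  have h2 := mul_le_mul_of_nonneg_left h1 (inv_nonneg.2 hn'.le)
  rw [mul_add, inv_mul_cancel_left₀ hn'.ne'] at h2
  linarith

/-! ### The two families of exceptional events -/

section Events

variable {k d n : ℕ} {Ω : Type*} [MeasurableSpace Ω] {P : Measure Ω} [IsProbabilityMeasure P]
  {ω : Fin n → Ω → (Fin k → Fin d)}

/-- A fibre over a pair of indices has probability `d⁻²`. -/
theorem measureReal_count_ge_le (hk : 2 ≤ k) (hd : 1 ≤ d) (hω : ∀ i, Measurable (ω i))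
    (hind : iIndepFun ω P) (hunif : ∀ i, P.map (ω i) = uniformOn Set.univ) {j₁ j₂ : Fin k}
    (hne : j₁ ≠ j₂) (p q : Fin d) (t : ℝ) :
    P.real {x | 2 * n / (d : ℝ) ^ 2 + t ≤
      ∑ i, (if ω i x j₁ = p then 1 else 0) * (if ω i x j₂ = q then (1 : ℝ) else 0)} ≤
      Real.exp (-t) := by
  have : NeZero d := ⟨by omega⟩
  have hd' : (d : ℝ) ≠ 0 := by positivity
  let f : (Fin k → Fin d) → ℝ :=
    fun a => (if a j₁ = p then 1 else 0) * (if a j₂ = q then (1 : ℝ) else 0)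
  have hsum : ∑ a, f a ≤ Fintype.card (Fin k → Fin d) * (1 / (d : ℝ) ^ 2) := by
    have h := sum_mul_le_pow (k := k) hne (g₁ := fun i : Fin d => if i = p then 1 else 0)
      (g₂ := fun i => if i = q then 1 else 0) (fun i => by positivity) (fun i => by positivity)
      (by simp) (by simp)
    refine h.trans_eq ?_
    rw [Fintype.card_pi_const, Fintype.card_fin, Nat.cast_pow, pow_sub₀ _ hd' hk]
    ring
  have hsq : ∀ a, f a ^ 2 = f a := fun a => by
    dsimp only [f]; split_ifs <;> norm_num
  have h := measureReal_sum_ge_le_exp hω hind hunif f (lam := 1) (m := 1 / (d : ℝ) ^ 2)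
    (s := 1 / (d : ℝ) ^ 2) t one_pos (fun a => by dsimp only [f]; split_ifs <;> norm_num) hsum
    (by simpa only [hsq] using hsum)
  have e : n * (1 / (d : ℝ) ^ 2 + 1 * (1 / (d : ℝ) ^ 2)) + t / 1 = 2 * n / (d : ℝ) ^ 2 + t := by
    ring
  rwa [e] at h

/-- Bernstein's inequality for the flat part, whose terms are bounded by `D θ` and have second
moment at most `D ^ 2 / d ^ 2`, where `D = δ ^ (k - 2) d ^ k ‖A‖_max`. -/
theorem measureReal_flatPart_ge_le (hk : 2 ≤ k) (hd : 1 ≤ d) (hω : ∀ i, Measurable (ω i))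
    (hind : iIndepFun ω P) (hunif : ∀ i, P.map (ω i) = uniformOn Set.univ) {A : Tensor k d}
    {δ θ D : ℝ} {j₁ j₂ : Fin k} (hne : j₁ ≠ j₂) {u : Fin k → EuclideanSpace ℝ (Fin d)}
    (hδ : 0 < δ) (hθ : 0 < θ) (hA : 0 < maxNorm A) (hu : IsTest δ j₁ j₂ u)
    (hD : D = δ ^ (k - 2) * d ^ k * maxNorm A) (t : ℝ) :
    P.real {x | n * (∑ a, A a * flatPart θ j₁ j₂ u a) + (n * D / (d ^ 2 * θ) + t * (D * θ)) ≤
      ∑ i, (d : ℝ) ^ k * (A (ω i x) * flatPart θ j₁ j₂ u (ω i x))} ≤ Real.exp (-t) := by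
  have : NeZero d := ⟨by omega⟩
  have hd' : (0 : ℝ) < d := by positivity
  have hDpos : 0 < D := by rw [hD]; positivity
  let f : (Fin k → Fin d) → ℝ := fun a => (d : ℝ) ^ k * (A a * flatPart θ j₁ j₂ u a)
  have hcard : (Fintype.card (Fin k → Fin d) : ℝ) = (d : ℝ) ^ k := by
    rw [Fintype.card_pi_const, Fintype.card_fin, Nat.cast_pow]
  have h := measureReal_sum_ge_le_exp hω hind hunif f (lam := (D * θ)⁻¹)
    (m := ∑ a, A a * flatPart θ j₁ j₂ u a) (s := D ^ 2 / d ^ 2) t (by positivity)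
    (fun a => ?_) ?_ ?_
  · have e : ∀ M : ℝ, n * (M + (D * θ)⁻¹ * (D ^ 2 / d ^ 2)) + t / (D * θ)⁻¹ =
        n * M + (n * D / (d ^ 2 * θ) + t * (D * θ)) := fun M => by
      field_simp
      ring
    rwa [e] at h
  · rw [inv_mul_le_iff₀ (by positivity), mul_one, hD]
    simp only [f, abs_mul, abs_pow, Nat.abs_cast]
    calc (d : ℝ) ^ k * (|A a| * |flatPart θ j₁ j₂ u a|)
        ≤ d ^ k * (maxNorm A * (θ * δ ^ (k - 2))) := by
          gcongr
          exacts [abs_le_maxNorm A a, hu.abs_flatPart_le hne hδ.le hθ.le a]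
      _ = _ := by ring
  · rw [hcard, Finset.mul_sum]
  · rw [hcard]
    calc ∑ a, f a ^ 2 ≤ ∑ a, ((d : ℝ) ^ k * maxNorm A) ^ 2 * flatPart θ j₁ j₂ u a ^ 2 := by
          refine Finset.sum_le_sum fun a _ => ?_
          have h1 : A a ^ 2 ≤ maxNorm A ^ 2 :=
            sq_le_sq.2 ((abs_le_maxNorm A a).trans (le_abs_self _))
          calc f a ^ 2 = ((d : ℝ) ^ k) ^ 2 * (A a ^ 2 * flatPart θ j₁ j₂ u a ^ 2) := by
                simp only [f]; ring
            _ ≤ ((d : ℝ) ^ k) ^ 2 * (maxNorm A ^ 2 * flatPart θ j₁ j₂ u a ^ 2) := by gcongr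
            _ = _ := by ring
      _ ≤ ((d : ℝ) ^ k * maxNorm A) ^ 2 * (d * δ ^ 2) ^ (k - 2) := by
          rw [← Finset.mul_sum]
          gcongr
          exact hu.sum_flatPart_sq_le hne
      _ = d ^ k * (D ^ 2 / d ^ 2) := by
          rw [hD, mul_pow (d : ℝ), pow_sub₀ _ hd'.ne' hk, ← pow_mul, mul_comm 2 (k - 2), pow_mul]
          field_simp

end Events

/-! ### The probability bound -/

/-- The bound for any threshold `θ` between the flat and the spiky part that satisfies `hθ₁` and
`hθ₂`. These make `d * lg * θ` dominate the variance term of the flat part and the spiky part; the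
failure probability is a union bound over all pairs of directions, test tuples and fibres. -/
theorem measureReal_incoherentNorm_le {k d n : ℕ} (hk : 2 ≤ k) (hd : 2 ≤ d) (hn : 1 ≤ n)
    {A : Tensor k d} (hA : 0 < maxNorm A) {δ : ℝ} (hδ : 0 < δ) {Ω : Type*} [MeasurableSpace Ω]
    {P : Measure Ω} [IsProbabilityMeasure P] {ω : Fin n → Ω → (Fin k → Fin d)}
    (hω : ∀ i, Measurable (ω i)) (hind : iIndepFun ω P)
    (hunif : ∀ i, P.map (ω i) = uniformOn Set.univ) {β : ℝ} (hβ : 0 < β) {lg θ D : ℝ}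
    (hlg : lg = Real.log d) (hθ : 0 < θ) (hθ₁ : 1 ≤ d * θ ^ 2) (hθ₂ : n ≤ d ^ 3 * lg * θ ^ 2)
    (hD : D = δ ^ (k - 2) * d ^ k * maxNorm A) :
    1 - 2 * (k : ℝ) ^ 2 * (d : ℝ) ^ (-β) ≤
      P.real {x | incoherentNorm (fun _ => δ) (sampleMean A (fun i => ω i x) - A) ≤
        2 ^ k * ((4 * k + 6 + 2 * β) * ((n : ℝ)⁻¹ * D * (d * lg * θ)))} := by
  have hn' : (0 : ℝ) < n := by exact_mod_cast hn
  have hd2 : (2 : ℝ) ≤ d := by exact_mod_cast hd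
  have hd' : (0 : ℝ) < d := by linarith
  have hlgpos : 0 < lg := hlg ▸ Real.log_pos (by linarith)
  have hDpos : 0 < D := by rw [hD]; positivity
  obtain ⟨G, hGcard, hGball, hGnet⟩ := exists_half_net_unitBall d (by omega)
  -- the two deviation levels: `t` for the test tensors, `t'` for the counts
  set t : ℝ := (4 * d * k + β) * lg with ht
  set t' : ℝ := (2 + β) * lg with ht'
  set N : ℝ := 2 * n / (d : ℝ) ^ 2 + t' with hN
  have hNnn : 0 ≤ N := by positivity
  let flatBad : Fin k → Fin k → (Fin k → EuclideanSpace ℝ (Fin d)) → Set Ω := fun j₁ j₂ u =>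
    {x | n * (∑ a, A a * flatPart θ j₁ j₂ u a) + (n * D / (d ^ 2 * θ) + t * (D * θ)) ≤
      ∑ i, (d : ℝ) ^ k * (A (ω i x) * flatPart θ j₁ j₂ u (ω i x))}
  let countBad : Fin k → Fin k → Fin d → Fin d → Set Ω := fun j₁ j₂ p q =>
    {x | N ≤ ∑ i, (if ω i x j₁ = p then 1 else 0) * (if ω i x j₂ = q then (1 : ℝ) else 0)}
  let pairs : Finset (Fin k × Fin k) := Finset.univ.filter fun j => j.1 < j.2
  have hpairs : (pairs.card : ℝ) ≤ (k : ℝ) ^ 2 := by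
    have : pairs.card ≤ k ^ 2 := (Finset.card_filter_le _ _).trans (by simp [sq])
    exact_mod_cast this
  let bad₁ : Set Ω := ⋃ j ∈ pairs, ⋃ u ∈ testFactors k G δ j.1 j.2, flatBad j.1 j.2 u
  let bad₂ : Set Ω := ⋃ j ∈ pairs, ⋃ pq ∈ (Finset.univ : Finset (Fin d × Fin d)),
    countBad j.1 j.2 pq.1 pq.2
  set good : Set Ω := {x | incoherentNorm (fun _ => δ) (sampleMean A (fun i => ω i x) - A) ≤
        2 ^ k * ((4 * k + 6 + 2 * β) * ((n : ℝ)⁻¹ * D * (d * lg * θ)))}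
  -- powers of `d` written as exponentials
  have hexp : ∀ m : ℕ, (d : ℝ) ^ m * Real.exp (-((m + β) * lg)) = (d : ℝ) ^ (-β) := fun m => by
    rw [← Real.rpow_natCast, Real.rpow_def_of_pos hd', Real.rpow_def_of_pos hd', ← Real.exp_add,
      hlg]
    congr 1; ring
  have hbad₁ : P.real bad₁ ≤ (k : ℝ) ^ 2 * (d : ℝ) ^ (-β) := by
    have hcount : ∀ j₁ j₂ : Fin k, ((testFactors k G δ j₁ j₂).card : ℝ) ≤
        (d : ℝ) ^ (4 * d * k) := by
      intro j₁ j₂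
      have h1 : 2 ^ d ≤ (4 * d + 1) ^ d := Nat.pow_le_pow_left (by omega) d
      have h2 : 4 * d + 1 ≤ d ^ 4 := by
        have : 2 ^ 3 ≤ d ^ 3 := Nat.pow_le_pow_left hd 3
        calc 4 * d + 1 ≤ 2 ^ 3 * d := by omega
          _ ≤ d ^ 3 * d := Nat.mul_le_mul_right d this
          _ = d ^ 4 := by ring
      have h3 : (testFactors k G δ j₁ j₂).card ≤ d ^ (4 * d * k) :=
        calc _ ≤ ((4 * d + 1) ^ d) ^ k := card_testFactors_le hGcard h1 δ j₁ j₂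
          _ ≤ ((d ^ 4) ^ d) ^ k := by gcongr
          _ = d ^ (4 * d * k) := by rw [← pow_mul, ← pow_mul, ← mul_assoc]
      exact_mod_cast h3
    have hpair : ∀ j ∈ pairs,
        P.real (⋃ u ∈ testFactors k G δ j.1 j.2, flatBad j.1 j.2 u) ≤ (d : ℝ) ^ (-β) := by
      intro j hj
      have hlt : j.1 < j.2 := (Finset.mem_filter.1 hj).2
      calc _ ≤ ∑ u ∈ testFactors k G δ j.1 j.2, P.real (flatBad j.1 j.2 u) :=
            measureReal_biUnion_finset_le _ _
        _ ≤ ∑ _u ∈ testFactors k G δ j.1 j.2, Real.exp (-t) := by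
            refine Finset.sum_le_sum fun u hu => ?_
            exact measureReal_flatPart_ge_le hk (by omega) hω hind hunif hlt.ne hδ hθ hA
              (isTest_of_mem_testFactors hGball hδ.le hu) hD t
        _ ≤ (d : ℝ) ^ (4 * d * k) * Real.exp (-t) := by
            rw [Finset.sum_const, nsmul_eq_mul]
            gcongr
            exact hcount _ _
        _ = (d : ℝ) ^ (-β) := by
            rw [← hexp (4 * d * k), ht]; push_cast; rfl
    calc P.real bad₁ ≤ ∑ j ∈ pairs, _ := measureReal_biUnion_finset_le _ _
      _ ≤ ∑ _j ∈ pairs, (d : ℝ) ^ (-β) := Finset.sum_le_sum hpair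
      _ ≤ _ := by
          rw [Finset.sum_const, nsmul_eq_mul]
          gcongr
  have hbad₂ : P.real bad₂ ≤ (k : ℝ) ^ 2 * (d : ℝ) ^ (-β) := by
    have hpair : ∀ j ∈ pairs, P.real (⋃ pq ∈ (Finset.univ : Finset (Fin d × Fin d)),
        countBad j.1 j.2 pq.1 pq.2) ≤ (d : ℝ) ^ (-β) := by
      intro j hj
      have hlt : j.1 < j.2 := (Finset.mem_filter.1 hj).2
      calc _ ≤ ∑ pq : Fin d × Fin d, P.real (countBad j.1 j.2 pq.1 pq.2) :=
            measureReal_biUnion_finset_le _ _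
        _ ≤ ∑ _pq : Fin d × Fin d, Real.exp (-t') := Finset.sum_le_sum fun pq _ =>
            measureReal_count_ge_le hk (by omega) hω hind hunif hlt.ne pq.1 pq.2 t'
        _ = (d : ℝ) ^ 2 * Real.exp (-t') := by simp; ring
        _ = (d : ℝ) ^ (-β) := by
            rw [← hexp 2, ht']; push_cast; rfl
    calc P.real bad₂ ≤ ∑ j ∈ pairs, _ := measureReal_biUnion_finset_le _ _
      _ ≤ ∑ _j ∈ pairs, (d : ℝ) ^ (-β) := Finset.sum_le_sum hpair
      _ ≤ _ := by
          rw [Finset.sum_const, nsmul_eq_mul]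
          gcongr
  have hcover : (Set.univ : Set Ω) ⊆ good ∪ (bad₁ ∪ bad₂) := by
    intro x _
    by_contra hx
    simp only [Set.mem_union, not_or] at hx
    obtain ⟨hxg, hx₁, hx₂⟩ := hx
    simp only [bad₁, bad₂, Set.mem_iUnion, not_exists] at hx₁ hx₂
    refine hxg (incoherentNorm_le_of_testFactors hGnet (by positivity) fun j₁ j₂ hlt u hu => ?_)
    have hj : (j₁, j₂) ∈ pairs := Finset.mem_filter.2 ⟨Finset.mem_univ _, hlt⟩
    have hflat := hx₁ (j₁, j₂) hj u hu
    have hcount := fun p q => hx₂ (j₁, j₂) hj (p, q) (Finset.mem_univ _)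
    simp only [flatBad, countBad, Set.mem_ofPred_eq, not_le] at hflat hcount
    refine (inner_rankOne_sampleMean_sub_le hn hlt.ne hδ.le hθ hNnn
      (isTest_of_mem_testFactors hGball hδ.le hu) (fun i => ω i x) hflat.le
      fun p q => (hcount p q).le).trans ?_
    -- all error terms are multiples of `d lg θ`, by the two properties of `θ`
    have e₁ : n / (d ^ 2 * θ) ≤ d * lg * θ := by
      rw [div_le_iff₀ (by positivity)]; linarith
    have e₂ : lg / θ ≤ d * lg * θ := by
      rw [div_le_iff₀ hθ]; nlinarith
    have hpow : (d : ℝ) ^ (k - 2) = d ^ k / d ^ 2 := by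
      rw [pow_sub₀ _ hd'.ne' hk]; rfl
    have e₃ : (n : ℝ)⁻¹ * (n * D / (d ^ 2 * θ) + t * (D * θ) +
          d ^ k * maxNorm A * (δ ^ (k - 2) / θ) * N) +
        maxNorm A * (δ ^ (k - 2) / θ) * d ^ (k - 2) =
        (n : ℝ)⁻¹ * D * (4 * (n / (d ^ 2 * θ)) + t * θ + (2 + β) * (lg / θ)) := by
      rw [hN, ht', hpow, hD]
      field_simp
      ring
    rw [e₃, mul_comm (4 * (k : ℝ) + 6 + 2 * β), mul_assoc _ (d * lg * θ)]
    refine mul_le_mul_of_nonneg_left ?_ (by positivity)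
    have e₄ : t * θ ≤ (4 * k + β) * (d * lg * θ) := by
      rw [ht]
      have : β * (lg * θ) ≤ β * (d * lg * θ) := by
        have h1 : (1 : ℝ) ≤ d := by linarith
        have h2 : lg * θ ≤ d * (lg * θ) := le_mul_of_one_le_left (by positivity) h1
        rw [mul_assoc (d : ℝ)]
        exact mul_le_mul_of_nonneg_left h2 hβ.le
      linarith
    have e₅ := mul_le_mul_of_nonneg_left e₂ (by linarith : 0 ≤ 2 + β)
    linarith
  have h1 : 1 ≤ P.real good + (P.real bad₁ + P.real bad₂) := by
    calc (1 : ℝ) = P.real Set.univ := by simp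
      _ ≤ P.real (good ∪ (bad₁ ∪ bad₂)) := measureReal_mono hcover
      _ ≤ P.real good + P.real (bad₁ ∪ bad₂) := measureReal_union_le _ _
      _ ≤ _ := by gcongr; exact measureReal_union_le _ _
  linarith

end Tensor

theorem mainTheorem4 (k : ℕ) (hk : 2 ≤ k) :
    ∃ c₁ c₂ : ℝ, 0 < c₁ ∧ 0 < c₂ ∧
      ∀ (d n : ℕ), 1 ≤ d → 1 ≤ n →
      ∀ (A : Tensor k d) (δ : ℝ), 0 < δ → δ ≤ 1 →
      ∀ (Ω : Type*) [MeasurableSpace Ω] (P : Measure Ω) [IsProbabilityMeasure P]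
        (ω : Fin n → Ω → (Fin k → Fin d)),
        (∀ i, Measurable (ω i)) → iIndepFun ω P →
        (∀ i, P.map (ω i) = uniformOn Set.univ) →
      ∀ β : ℝ, 0 < β →
        1 - c₂ * (d : ℝ) ^ (-β) ≤
          P.real {x | Tensor.incoherentNorm (fun _ => δ)
              (Tensor.sampleMean A (fun i => ω i x) - A) ≤
            c₁ * (1 + β) *
              max (Real.sqrt (Real.log d / n) * δ ^ (k - 2) * (d : ℝ) ^ ((k : ℝ) - 1 / 2))
                (Real.log d / n * δ ^ (k - 2) * (d : ℝ) ^ ((k : ℝ) + 1 / 2)) *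
              Tensor.maxNorm A} := by
  have hk2 : (2 : ℝ) ≤ k := by exact_mod_cast hk
  refine ⟨2 ^ k * (4 * k + 6), 2 * (k : ℝ) ^ 2, by positivity, by positivity, ?_⟩
  intro d n hd hn A δ hδ _ Ω _ P _ ω hω hind hunif β hβ
  have hd' : (0 : ℝ) < d := by exact_mod_cast hd
  have hn' : (0 : ℝ) < n := by exact_mod_cast hn
  have hM : 0 ≤ Tensor.maxNorm A := Real.iSup_nonneg fun _ => abs_nonneg _
  -- for `d = 1` the claimed probability is not positive
  rcases hd.eq_or_lt with rfl | hd2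
  · refine le_trans ?_ measureReal_nonneg
    rw [Nat.cast_one, Real.one_rpow]
    nlinarith
  rcases hM.eq_or_lt with hA0 | hA
  · -- for `A = 0` the deviation vanishes identically
    have hA' : A = 0 := by
      ext a
      exact abs_nonpos_iff.1 ((Tensor.abs_le_maxNorm A a).trans hA0.symm.le)
    have hmean : ∀ x, Tensor.sampleMean A (fun i => ω i x) - A = 0 := fun x => by
      subst hA'
      ext a
      simp [Tensor.sampleMean, Tensor.sample]
    have huniv : ∀ c : ℝ, P.real {x | Tensor.incoherentNorm (fun _ => δ)
        (Tensor.sampleMean A (fun i => ω i x) - A) ≤ c * Tensor.maxNorm A} = 1 := by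
      intro c
      have : {x | Tensor.incoherentNorm (fun _ => δ)
          (Tensor.sampleMean A (fun i => ω i x) - A) ≤ c * Tensor.maxNorm A} = Set.univ := by
        refine Set.eq_univ_of_forall fun x => ?_
        rw [Set.mem_ofPred_eq, hmean, ← hA0, mul_zero]
        refine Real.sSup_le ?_ le_rfl
        rintro _ ⟨Y, -, rfl⟩
        simp [Tensor.inner]
      rw [this]; simp
    rw [huniv]
    have : 0 ≤ 2 * (k : ℝ) ^ 2 * (d : ℝ) ^ (-β) := by positivity
    linarith
  have hlg : 0 < Real.log d := Real.log_pos (by exact_mod_cast hd2)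
  set lg := Real.log d with hlgdef
  set D := δ ^ (k - 2) * d ^ k * Tensor.maxNorm A with hD
  -- the target is `D * τ`, and `θ = n τ / (d lg)` balances the flat and the spiky contributions
  set τ : ℝ := max (Real.sqrt (lg / n) / Real.sqrt d) (lg / n * Real.sqrt d) with hτ
  have hsd : 0 < Real.sqrt d := Real.sqrt_pos.2 hd'
  have hsq : Real.sqrt d ^ 2 = d := Real.sq_sqrt hd'.le
  have hτpos : 0 < τ := lt_max_of_lt_right (by positivity)
  have hτ₁ : lg / (n * d) ≤ τ ^ 2 := by
    calc lg / (n * d) = (Real.sqrt (lg / n) / Real.sqrt d) ^ 2 := by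
          rw [div_pow, Real.sq_sqrt (by positivity), hsq, div_div]
      _ ≤ τ ^ 2 := pow_le_pow_left₀ (by positivity) (le_max_left _ _) 2
  have hτ₂ : lg ^ 2 / n ^ 2 * d ≤ τ ^ 2 := by
    calc lg ^ 2 / n ^ 2 * d = (lg / n * Real.sqrt d) ^ 2 := by
          rw [mul_pow, hsq, div_pow]
      _ ≤ τ ^ 2 := pow_le_pow_left₀ (by positivity) (le_max_right _ _) 2
  set θ : ℝ := n * τ / (d * lg) with hθ
  have hθ₁ : 1 ≤ d * θ ^ 2 := by
    have h : d * θ ^ 2 = n ^ 2 / (d * lg ^ 2) * τ ^ 2 := by rw [hθ]; field_simp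
    calc (1 : ℝ) = n ^ 2 / (d * lg ^ 2) * (lg ^ 2 / n ^ 2 * d) := by field_simp
      _ ≤ n ^ 2 / (d * lg ^ 2) * τ ^ 2 := by gcongr
      _ = d * θ ^ 2 := h.symm
  have hθ₂ : n ≤ d ^ 3 * lg * θ ^ 2 := by
    have h : d ^ 3 * lg * θ ^ 2 = d * n ^ 2 / lg * τ ^ 2 := by rw [hθ]; field_simp
    calc (n : ℝ) = d * n ^ 2 / lg * (lg / (n * d)) := by field_simp
      _ ≤ d * n ^ 2 / lg * τ ^ 2 := by gcongr
      _ = d ^ 3 * lg * θ ^ 2 := h.symm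
  have hmain := Tensor.measureReal_incoherentNorm_le hk hd2 hn hA hδ hω hind hunif hβ hlgdef
    (by positivity : 0 < θ) hθ₁ hθ₂ hD
  refine hmain.trans (measureReal_mono fun x hx => ?_)
  rw [Set.mem_ofPred_eq] at hx ⊢
  refine hx.trans ?_
  have htarget : max (Real.sqrt (lg / n) * δ ^ (k - 2) * (d : ℝ) ^ ((k : ℝ) - 1 / 2))
      (lg / n * δ ^ (k - 2) * (d : ℝ) ^ ((k : ℝ) + 1 / 2)) * Tensor.maxNorm A = D * τ := by
    rw [Real.rpow_sub hd', Real.rpow_add hd', Real.rpow_natCast, ← Real.sqrt_eq_rpow,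
      hτ, mul_max_of_nonneg _ _ (by positivity : 0 ≤ D), max_mul_of_nonneg _ _ hM, hD]
    congr 1 <;> ring
  have hθτ : (n : ℝ)⁻¹ * D * (d * lg * θ) = D * τ := by
    rw [hθ]; field_simp
  rw [mul_assoc _ (max _ _), htarget, hθτ, mul_assoc (2 ^ k : ℝ), mul_assoc (2 ^ k : ℝ)]
  have hDτ : 0 < D * τ := by positivity
  refine mul_le_mul_of_nonneg_left (mul_le_mul_of_nonneg_right ?_ hDτ.le) (by positivity)
  nlinarith
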